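/- Let $G$ and $H$ be countable discrete groups acting by homeomorphisms on compact Hausdorff spaces $X$ and $Y$ respectively. Assume that both actions are topologically free (the points with trivial stabilizer are dense) and that they are continuously orbit equivalent: there are a homeomorphism $\varphi\colon X\to Y$ and continuous maps $c\colon G\times X\to H$, $c'\colon H\times Y\to G$ such that $\varphi(gx)=c(g,x)\varphi(x)$ and $\varphi^{-1}(hy)=c'(h,y)\varphi^{-1}(y)$ for all $g\in G$, $h\in H$, $x\in X$, $y\in Y$. Then, as real vector spaces, $$H^{uf}_0(G\curvearrowright X)\cong H^{uf}_0(H\curvearrowright Y)\qquad\text{and}\qquad H_n(G,N_0(G,X)^*)\cong H_n(H,N_0(H,Y)^*)\quad\text{for every } n\ge 0.$$ Here $C(X,\ell^1(G))$ is the real Banach space of continuous maps $\xi\colon X\to\ell^1(G)$, $x\mapsto\xi_x$, with the norm $\sup_x\sum_g|\xi_x(g)|$ and the $G$-action $(g\xi)_x(h)=\xi_{g^{-1}x}(g^{-1}h)$. The closed $G$-invariant subspaces $N_0(G,X)\subseteq W_0(G,X)$ consist of those $\xi$ for which $x\mapsto\sum_g\xi_x(g)$ is identically zero, respectively constant on $X$.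 The Banach dual $V^*$ of a $G$-module $V$ carries the action $(g\tau)(\xi)=\tau(g^{-1}\xi)$. For a real linear representation $V$ of $G$, $H_n(G,V)=\operatorname{Ker}\partial_n/\operatorname{Im}\partial_{n+1}$ is the group homology computed by the bar complex $C_n=C_f(G^n,V)$ of finitely supported maps, with $\partial_0=0$ and, for $n\ge1$, writing $v\cdot(g_1,\dots,g_n)$ for the map supported at $(g_1,\dots,g_n)$ with value $v$, $$\partial_n\bigl(v\cdot(g_1,\dots,g_n)\bigr)=g_1^{-1}v\cdot(g_2,\dots,g_n)+\sum_{i=1}^{n-1}(-1)^i\,v\cdot(g_1,\dots,g_ig_{i+1},\dots,g_n)+(-1)^n\,v\cdot(g_1,\dots,g_{n-1}).$$ Finally, $H^{uf}_n(G\curvearrowright X):=H_n(G,W_0(G,X)^*)$. -/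

import Mathlib

noncomputable section

namespace COEHomology

section Bar

variable {G V : Type*} [Group G] [AddCommGroup V] [Module ℝ V]

/-- The bar differential `∂ₙ₊₁ : C_f(Gⁿ⁺¹, V) → C_f(Gⁿ, V)`, for a linear `G`-representation `V`.
On the chain `v · (g₀, …, gₙ)` it is `g₀⁻¹ v · (g₁, …, gₙ)` plus
`∑_{i = 1}^{n} (-1)ⁱ v · (g₀, …, gᵢ₋₁ gᵢ, …, gₙ)` plus `(-1)ⁿ⁺¹ v · (g₀, …, gₙ₋₁)`
(`Fin.contractNth j` multiplies the entries `j` and `j + 1`, or drops the last entry if `j`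
is the last index). -/
def barD (ρ : Representation ℝ G V) (n : ℕ) :
    ((Fin (n + 1) → G) →₀ V) →ₗ[ℝ] ((Fin n → G) →₀ V) :=
  Finsupp.lsum (R := ℝ) ℝ fun g =>
    Finsupp.lsingle (fun i => g i.succ) ∘ₗ ρ (g 0)⁻¹ +
      Finset.univ.sum fun j : Fin (n + 1) =>
        (-1 : ℝ) ^ ((j : ℕ) + 1) • Finsupp.lsingle (Fin.contractNth j (· * ·) g)

/-- The `n`-cycles `Ker ∂ₙ` (with `∂₀ = 0`). -/
def barCycles (ρ : Representation ℝ G V) : (n : ℕ) → Submodule ℝ ((Fin n → G) →₀ V)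
  | 0 => ⊤
  | n + 1 => LinearMap.ker (barD ρ n)

/-- The group homology `Hₙ(G, V) = Ker ∂ₙ / Im ∂ₙ₊₁`, computed by the bar complex. -/
abbrev barHomology (ρ : Representation ℝ G V) (n : ℕ) : Type _ :=
  barCycles ρ n ⧸ (LinearMap.range (barD ρ n)).submoduleOf (barCycles ρ n)

end Bar

section Modules

/-- The real Banach space `ℓ¹(G)`. -/
abbrev EllOne (G : Type*) : Type _ := lp (fun _ : G => ℝ) 1

/-- Left translation on `ℓ¹(G)`: `(g · a)(h) = a(g⁻¹ h)`. -/
def ellOneTranslate {G : Type*} [Group G] (g : G) : EllOne G →L[ℝ] EllOne G :=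
  LinearMap.mkContinuous
    { toFun := fun a => ⟨fun h => a (g⁻¹ * h), by
        have h1 := (memℓp_gen_iff (by simp)).1 (lp.memℓp a)
        exact (memℓp_gen_iff (by simp)).2 ((Equiv.mulLeft g⁻¹).summable_iff.2 h1)⟩
      map_add' := fun _ _ => rfl
      map_smul' := fun _ _ => rfl } 1 (by
    intro a
    rw [one_mul, lp.norm_eq_tsum_rpow (by simp), lp.norm_eq_tsum_rpow (by simp)]
    apply le_of_eq
    congr 1
    exact (Equiv.mulLeft g⁻¹).tsum_eq fun h => ‖a h‖ ^ (1 : ENNReal).toReal)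

variable (G X : Type*) [TopologicalSpace X]

/-- `C(X, ℓ¹(G))`; for compact `X` it carries the norm `‖ξ‖ = sup_x ∑_g |ξ_x(g)|`. -/
abbrev CEllOne : Type _ := C(X, EllOne G)

/-- The map `σ : C(X, ℓ¹(G)) → C(X)` induced by summation `ℓ¹(G) → ℝ`. -/
def sigma : CEllOne G X →L[ℝ] C(X, ℝ) :=
  ContinuousLinearMap.compLeftContinuous ℝ X (lp.tsumCLM ℝ G ℝ)

/-- `N₀(G, X) = σ⁻¹(0)`. -/
def N0 : Submodule ℝ (CEllOne G X) := LinearMap.ker (sigma G X).toLinearMap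

/-- `W₀(G, X) = σ⁻¹(ℝ)`, with `ℝ` the constant functions on `X`. -/
def W0 : Submodule ℝ (CEllOne G X) :=
  (ℝ ∙ (1 : C(X, ℝ))).comap (sigma G X).toLinearMap

variable {G X}

theorem sigma_apply (ξ : CEllOne G X) (x : X) : sigma G X ξ x = ∑' g, ξ x g := rfl

theorem mem_N0 (ξ : CEllOne G X) : ξ ∈ N0 G X ↔ ∀ x, sigma G X ξ x = 0 := by
  simp [N0, ContinuousMap.ext_iff]

theorem mem_W0 (ξ : CEllOne G X) : ξ ∈ W0 G X ↔ ∃ r : ℝ, ∀ x, sigma G X ξ x = r := by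
  simp [W0, Submodule.mem_span_singleton, ContinuousMap.ext_iff, eq_comm]

variable [Group G] [MulAction G X] [ContinuousConstSMul G X]

/-- The action of `g` on `C(X, ℓ¹(G))`: `(g · ξ)_x(h) = ξ_{g⁻¹ x}(g⁻¹ h)`. -/
def translate (g : G) : CEllOne G X →L[ℝ] CEllOne G X :=
  (ContinuousLinearMap.compLeftContinuous ℝ X (ellOneTranslate g)).comp
    (ContinuousMap.compCLM ℝ (EllOne G) ⟨fun x : X => g⁻¹ • x, continuous_const_smul g⁻¹⟩)

theorem translate_apply (g : G) (ξ : CEllOne G X) (x : X) (h : G) :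
    translate g ξ x h = ξ (g⁻¹ • x) (g⁻¹ * h) := rfl

theorem sigma_translate (g : G) (ξ : CEllOne G X) (x : X) :
    sigma G X (translate g ξ) x = sigma G X ξ (g⁻¹ • x) :=
  (Equiv.mulLeft g⁻¹).tsum_eq fun h => ξ (g⁻¹ • x) h

theorem translate_mem_N0 (g : G) (ξ : CEllOne G X) (hξ : ξ ∈ N0 G X) :
    translate g ξ ∈ N0 G X := by
  rw [mem_N0] at hξ ⊢
  intro x
  rw [sigma_translate]
  exact hξ _

theorem translate_mem_W0 (g : G) (ξ : CEllOne G X) (hξ : ξ ∈ W0 G X) :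
    translate g ξ ∈ W0 G X := by
  rw [mem_W0] at hξ ⊢
  obtain ⟨r, hr⟩ := hξ
  exact ⟨r, fun x => by rw [sigma_translate]; exact hr _⟩

theorem translate_one (ξ : CEllOne G X) : translate (1 : G) ξ = ξ := by
  ext x h
  simp [translate_apply]

theorem translate_mul (g₁ g₂ : G) (ξ : CEllOne G X) :
    translate (g₁ * g₂) ξ = translate g₁ (translate g₂ ξ) := by
  ext x h
  simp [translate_apply, mul_smul, mul_assoc]

variable (G X)

/-- The `G`-module `N₀(G, X)`: the restriction of the action on `C(X, ℓ¹(G))`. -/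
def N0Action : G →* (N0 G X →L[ℝ] N0 G X) where
  toFun g := (translate g).restrict (translate_mem_N0 g)
  map_one' := by
    ext1 ξ
    exact Subtype.ext (translate_one _)
  map_mul' g₁ g₂ := by
    ext1 ξ
    exact Subtype.ext (translate_mul _ _ _)

/-- The `G`-module `W₀(G, X)`: the restriction of the action on `C(X, ℓ¹(G))`. -/
def W0Action : G →* (W0 G X →L[ℝ] W0 G X) where
  toFun g := (translate g).restrict (translate_mem_W0 g)
  map_one' := by
    ext1 ξ
    exact Subtype.ext (translate_one _)
  map_mul' g₁ g₂ := by
    ext1 ξ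
    exact Subtype.ext (translate_mul _ _ _)

end Modules

/-- The Banach dual `V*` of a `G`-module `V`: `(g φ)(ξ) = φ(g⁻¹ ξ)`. -/
def dualRep {G V : Type*} [Group G] [AddCommGroup V] [Module ℝ V] [TopologicalSpace V]
    (ρ : G →* (V →L[ℝ] V)) : Representation ℝ G (StrongDual ℝ V) where
  toFun g :=
    { toFun := fun φ => φ.comp (ρ g⁻¹)
      map_add' := fun _ _ => rfl
      map_smul' := fun _ _ => rfl }
  map_one' := by
    ext φ ξ
    simp
  map_mul' g₁ g₂ := by
    refine LinearMap.ext fun φ => ContinuousLinearMap.ext fun ξ => ?_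
    change φ (ρ (g₁ * g₂)⁻¹ ξ) = φ (ρ g₂⁻¹ (ρ g₁⁻¹ ξ))
    rw [mul_inv_rev, map_mul]
    rfl

section Homology

variable (G X : Type*) [Group G] [TopologicalSpace X] [MulAction G X] [ContinuousConstSMul G X]

/-- The group homology `Hₙ(G, N₀(G, X)*)`. -/
abbrev homologyN0Dual (n : ℕ) : Type _ := barHomology (dualRep (N0Action G X)) n

/-- The uniformly finite homology `Hₙᵘᶠ(G ↷ X) = Hₙ(G, W₀(G, X)*)`. -/
abbrev ufHomology (n : ℕ) : Type _ := barHomology (dualRep (W0Action G X)) n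

end Homology

/-- Topologically free: the points with trivial stabilizer are dense. -/
def TopologicallyFree (G X : Type*) [Group G] [TopologicalSpace X] [MulAction G X] : Prop :=
  Dense {x : X | MulAction.stabilizer G x = ⊥}

/-- Continuous orbit equivalence of `G ↷ X` and `H ↷ Y`. -/
def ContinuouslyOrbitEquivalent (G X H Y : Type*) [Group G] [TopologicalSpace G]
    [TopologicalSpace X] [MulAction G X] [Group H] [TopologicalSpace H]
    [TopologicalSpace Y] [MulAction H Y] : Prop :=
  ∃ (φ : X ≃ₜ Y) (c : C(G × X, H)) (c' : C(H × Y, G)),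
    (∀ g x, φ (g • x) = c (g, x) • φ x) ∧
    (∀ h y, φ.symm (h • y) = c' (h, y) • φ.symm y)

end COEHomology

end

noncomputable section

/-! ### Orbit equivalence as an isomorphism of groupoids -/

namespace COEHomology

/-! Topological freeness makes an arrow of the transformation groupoid determined, by density and
continuity, by how it moves points. Hence `c` is a cocycle with inverse `c'`, and the two groupoids
are isomorphic (`exists_transformationGroupoidEquiv`).

A map `Gⁿ → N₀(G, X)` is a function of a point `x`, a string of `n` composable arrows ending at `x`,
and one further arrow, so it can be pulled back along the isomorphism (`pull`). The string in `H`
depends on `x`, but in a locally constant way with finitely many values; and `N₀` is stable under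
multiplication by indicators of clopen sets, so the pullback stays in `N₀`. It commutes with
coboundaries (`pull_barCoboundary`). Finitely supported chains with values in `N₀*` pair faithfully
with such maps, and the bar differential is adjoint to the coboundary; so the adjoint of the
pullback is an isomorphism of bar complexes.

`W₀` is not stable under cutting off, since sums must stay constant. In degree zero this can be
avoided: transport of `W₀` itself identifies the `0`-chains. Boundaries are sums of `τ ∘ (g - 1)`,
and `g - 1` maps `W₀` into `N₀`, so only `τ` restricted to `N₀` matters. That restriction can be cut
up and extended back to `W₀` by Hahn–Banach (`chainEquivW0_mem_range`). -/

/-- An isomorphism of the transformation groupoids `G ⋉ X ≅ H ⋉ Y`. The arrow from `g⁻¹ • x` to `x`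
given by `g` is sent to the arrow from `(arrow x g)⁻¹ • base x` to `base x`. -/
structure TransformationGroupoidEquiv (G X H Y : Type*) [Group G] [TopologicalSpace X]
    [MulAction G X] [Group H] [TopologicalSpace Y] [MulAction H Y] where
  base : X ≃ₜ Y
  arrow : X → G ≃ H
  base_inv_smul : ∀ g x, base (g⁻¹ • x) = (arrow x g)⁻¹ • base x
  arrow_mul : ∀ x g₁ g₂, arrow x (g₁ * g₂) = arrow x g₁ * arrow (g₁⁻¹ • x) g₂
  isLocallyConstant_arrow : ∀ g, IsLocallyConstant fun x => arrow x g

/-- Two continuous maps to a discrete group that move the points of `X` in the same way, along a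
homeomorphism onto a topologically free space, agree. -/
theorem eq_of_smul_eq {H X Y : Type*} [Group H] [TopologicalSpace H] [DiscreteTopology H]
    [TopologicalSpace X] [TopologicalSpace Y] [MulAction H Y] (hY : TopologicallyFree H Y)
    (φ : X ≃ₜ Y) {f₁ f₂ : X → H} (h₁ : Continuous f₁) (h₂ : Continuous f₂)
    (h : ∀ x, f₁ x • φ x = f₂ x • φ x) : f₁ = f₂ := by
  -- Points of `X` lying over points with trivial stabilizer are dense, so agreement there is
  -- enough.
  refine Continuous.ext_on (hY.preimage φ.isOpenMap) h₁ h₂ fun x hx => ?_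
  have hx' : MulAction.stabilizer H (φ x) = ⊥ := hx
  have hmem : (f₂ x)⁻¹ * f₁ x ∈ MulAction.stabilizer H (φ x) := by
    rw [MulAction.mem_stabilizer_iff, mul_smul, h, inv_smul_smul]
  rw [hx', Subgroup.mem_bot, inv_mul_eq_one] at hmem
  exact hmem.symm

theorem ContinuouslyOrbitEquivalent.exists_transformationGroupoidEquiv {G H X Y : Type*}
    [Group G] [TopologicalSpace G] [DiscreteTopology G]
    [Group H] [TopologicalSpace H] [DiscreteTopology H]
    [TopologicalSpace X] [MulAction G X] [ContinuousConstSMul G X]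
    [TopologicalSpace Y] [MulAction H Y] [ContinuousConstSMul H Y]
    (hX : TopologicallyFree G X) (hY : TopologicallyFree H Y)
    (hcoe : ContinuouslyOrbitEquivalent G X H Y) :
    Nonempty (TransformationGroupoidEquiv G X H Y) := by
  obtain ⟨φ, c, c', hc, hc'⟩ := hcoe
  have hcg (g : G) : Continuous fun x => c (g, x) := by fun_prop
  have hch (h : H) : Continuous fun y => c' (h, y) := by fun_prop
  have hmul (g₁ g₂ : G) (x : X) : c (g₁ * g₂, x) = c (g₁, g₂ • x) * c (g₂, x) := by
    refine congrFun (eq_of_smul_eq hY φ (f₁ := fun x => c (g₁ * g₂, x))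
      (f₂ := fun x => c (g₁, g₂ • x) * c (g₂, x)) (hcg _)
      (((hcg g₁).comp (continuous_const_smul g₂)).mul (hcg g₂)) fun x => ?_) x
    rw [← hc, mul_smul, mul_smul, ← hc, ← hc]
  have hleft (g : G) (x : X) : c' (c (g, x), φ x) = g := by
    refine congrFun (eq_of_smul_eq hX (Homeomorph.refl X) (f₁ := fun x => c' (c (g, x), φ x))
      (f₂ := fun _ => g) (by fun_prop) continuous_const fun x => ?_) x
    have := hc' (c (g, x)) (φ x)
    rw [← hc, φ.symm_apply_apply, φ.symm_apply_apply] at this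
    exact this.symm
  have hright (h : H) (y : Y) : c (c' (h, y), φ.symm y) = h := by
    refine congrFun (eq_of_smul_eq hY (Homeomorph.refl Y)
      (f₁ := fun y => c (c' (h, y), φ.symm y))
      (f₂ := fun _ => h) (by fun_prop) continuous_const fun y => ?_) y
    have := hc (c' (h, y)) (φ.symm y)
    rw [← hc', φ.apply_symm_apply, φ.apply_symm_apply] at this
    exact this.symm
  -- Arrows are indexed by their target `x`, whereas `c (g, x)` has source `x`; hence the two
  -- inversions.
  refine ⟨{
    base := φ
    arrow := fun x =>
      { toFun := fun g => (c (g⁻¹, x))⁻¹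
        invFun := fun h => (c' (h⁻¹, φ x))⁻¹
        left_inv := fun g => by simp [hleft]
        right_inv := fun h => by
          have := hright h⁻¹ (φ x)
          rw [φ.symm_apply_apply] at this
          simp [this] }
    base_inv_smul := fun g x => by simp [hc]
    arrow_mul := fun x g₁ g₂ => by simp [hmul]
    isLocallyConstant_arrow := fun g =>
      ((IsLocallyConstant.iff_continuous _).2 (hcg g⁻¹)).inv }⟩

namespace TransformationGroupoidEquiv

/-! ### Strings of composable arrows -/

section Basic

variable {G X H Y : Type*} [Group G] [TopologicalSpace X]
  [MulAction G X] [Group H] [TopologicalSpace Y] [MulAction H Y]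
  (E : TransformationGroupoidEquiv G X H Y)

theorem arrow_one (x : X) : E.arrow x 1 = 1 := by
  have := E.arrow_mul x 1 1
  simpa using this

theorem arrow_inv_smul (x : X) (g k : G) :
    E.arrow (g⁻¹ • x) (g⁻¹ * k) = (E.arrow x g)⁻¹ * E.arrow x k := by
  rw [eq_inv_mul_iff_mul_eq, ← E.arrow_mul, mul_inv_cancel_left]

/-- The inverse isomorphism. -/
def symm : TransformationGroupoidEquiv H Y G X where
  base := E.base.symm
  arrow y := (E.arrow (E.base.symm y)).symm
  base_inv_smul h y := by
    rw [Homeomorph.symm_apply_eq, E.base_inv_smul]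
    simp
  arrow_mul y h₁ h₂ := by
    have key : E.base.symm (h₁⁻¹ • y) =
        ((E.arrow (E.base.symm y)).symm h₁)⁻¹ • E.base.symm y := by
      rw [Homeomorph.symm_apply_eq, E.base_inv_smul]
      simp
    rw [Equiv.symm_apply_eq, E.arrow_mul, Equiv.apply_symm_apply, key, Equiv.apply_symm_apply]
  isLocallyConstant_arrow h := by
    refine IsLocallyConstant.iff_isOpen_fiber.2 fun g => ?_
    have := ((E.isLocallyConstant_arrow g).isOpen_fiber h).preimage E.base.symm.continuous
    convert this using 1
    ext y
    simp only [Set.mem_preimage, Set.mem_singleton_iff, Set.mem_ofPred_eq]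
    rw [Equiv.symm_apply_eq, eq_comm]

theorem symm_symm : E.symm.symm = E := by
  obtain ⟨base, arrow, _, _, _⟩ := E
  simp only [symm, mk.injEq]
  exact ⟨rfl, by ext x g; simp⟩

@[simp] theorem symm_base (y : Y) : E.symm.base y = E.base.symm y := rfl

@[simp] theorem symm_base_symm (x : X) : E.symm.base.symm x = E.base x := rfl

@[simp] theorem symm_arrow (y : Y) : E.symm.arrow y = (E.arrow (E.base.symm y)).symm := rfl

/-- The map induced on composable strings of arrows ending at `x`. -/
def arrowSeq {n : ℕ} (x : X) (g : Fin n → G) (i : Fin n) : H :=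
  (E.arrow x (Fin.partialProd g i.castSucc))⁻¹ * E.arrow x (Fin.partialProd g i.succ)

/-- A string is determined by its partial products, all of which are arrows ending at the same `x`.
On these the induced map is simply `E.arrow x`, which reduces the compatibilities below to
`Fin.partialProd_injective`. -/
theorem partialProd_arrowSeq {n : ℕ} (x : X) (g : Fin n → G) (i : Fin (n + 1)) :
    Fin.partialProd (E.arrowSeq x g) i = E.arrow x (Fin.partialProd g i) := by
  induction i using Fin.induction with
  | zero => simp [arrow_one]
  | succ i ih => rw [Fin.partialProd_succ, ih, arrowSeq, mul_inv_cancel_left]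

theorem _root_.Fin.partialProd_injective {M : Type*} [Group M] {n : ℕ} :
    Function.Injective (Fin.partialProd : (Fin n → M) → Fin (n + 1) → M) := fun f f' h => by
  ext i
  rw [← Fin.partialProd_right_inv f, h, Fin.partialProd_right_inv]

theorem arrowSeq_contractNth {n : ℕ} (x : X) (g : Fin (n + 1) → G) (j : Fin (n + 1)) :
    E.arrowSeq x (j.contractNth (· * ·) g) = j.contractNth (· * ·) (E.arrowSeq x g) := by
  apply Fin.partialProd_injective
  ext i
  rw [partialProd_arrowSeq, Fin.partialProd_contractNth, Fin.partialProd_contractNth]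
  simp [partialProd_arrowSeq]

theorem arrowSeq_zero {n : ℕ} (x : X) (g : Fin (n + 1) → G) :
    E.arrowSeq x g 0 = E.arrow x (g 0) := by
  rw [arrowSeq, Fin.partialProd_succ, Fin.castSucc_zero, Fin.partialProd_zero, arrow_one,
    inv_one, one_mul, one_mul]

/-- Dropping the first arrow moves the common target from `x` to `(g 0)⁻¹ • x`. -/
theorem arrowSeq_tail {n : ℕ} (x : X) (g : Fin (n + 1) → G) :
    E.arrowSeq ((g 0)⁻¹ • x) (fun i => g i.succ) = fun i => E.arrowSeq x g i.succ := by
  apply Fin.partialProd_injective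
  ext i
  have h₁ := Fin.partialProd_succ' g i
  have h₂ := Fin.partialProd_succ' (E.arrowSeq x g) i
  rw [partialProd_arrowSeq, arrowSeq_zero] at h₂
  change Fin.partialProd _ i = Fin.partialProd (Fin.tail (E.arrowSeq x g)) i
  rw [partialProd_arrowSeq, eq_inv_mul_of_mul_eq h₂.symm, ← arrow_inv_smul, h₁,
    inv_mul_cancel_left]
  rfl

theorem arrowSeq_symm_arrowSeq {n : ℕ} (x : X) (g : Fin n → G) :
    E.symm.arrowSeq (E.base x) (E.arrowSeq x g) = g := by
  apply Fin.partialProd_injective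
  ext i
  simp [partialProd_arrowSeq]

theorem isLocallyConstant_arrowSeq {n : ℕ} (g : Fin n → G) :
    IsLocallyConstant fun x => E.arrowSeq x g := by
  refine (IsLocallyConstant.iff_eventually_eq _).2 fun x => ?_
  have := Filter.eventually_all.2 fun i =>
    (E.isLocallyConstant_arrow (Fin.partialProd g i)).eventually_eq x
  filter_upwards [this] with x' hx'
  ext i
  simp only [arrowSeq, hx']

end Basic

end TransformationGroupoidEquiv

/-! ### Transport and cutting off of `ℓ¹`-valued functions -/

section Transport

/-- The isometry `ℓ¹(G) → ℓ¹(H)` induced by a bijection. -/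
def ellOneCongr {G H : Type*} (e : G ≃ H) : EllOne G →ₗᵢ[ℝ] EllOne H where
  toFun a := ⟨fun h => a (e.symm h), by
    have h1 := (memℓp_gen_iff (by simp)).1 (lp.memℓp a)
    exact (memℓp_gen_iff (by simp)).2 (e.symm.summable_iff.2 h1)⟩
  map_add' _ _ := rfl
  map_smul' _ _ := rfl
  norm_map' a := by
    rw [lp.norm_eq_tsum_rpow (by simp), lp.norm_eq_tsum_rpow (by simp)]
    congr 1
    exact e.symm.tsum_eq fun h => ‖a h‖ ^ (1 : ENNReal).toReal

theorem ellOneCongr_apply {G H : Type*} (e : G ≃ H) (a : EllOne G) (h : H) :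
    ellOneCongr e a h = a (e.symm h) := rfl

open Classical in
theorem ellOneCongr_single {G H : Type*} (e : G ≃ H) (g : G) (r : ℝ) :
    ellOneCongr e (lp.single 1 g r) = lp.single 1 (e g) r := by
  ext h
  simp [ellOneCongr_apply, lp.single_apply, Pi.single_apply, Equiv.symm_apply_eq]

-- Expanding `a` into point masses gives a series of locally constant terms dominated by `‖a g‖`, so
-- the Weierstrass test applies.
open Classical in
theorem continuous_ellOneCongr_const {G H X : Type*} [TopologicalSpace X] {e : X → G ≃ H}
    (he : ∀ g, IsLocallyConstant fun x => e x g) (a : EllOne G) :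
    Continuous fun x => ellOneCongr (e x) a := by
  have hsum (x : X) : ellOneCongr (e x) a = ∑' g, lp.single 1 (e x g) (a g) := by
    have := (lp.hasSum_single ENNReal.one_ne_top a).mapL
      (ellOneCongr (e x)).toContinuousLinearMap
    simpa only [LinearIsometry.coe_toContinuousLinearMap, ellOneCongr_single]
      using this.tsum_eq.symm
  simp_rw [hsum]
  refine continuous_tsum (u := fun g => ‖a g‖) (fun g => ?_) ?_ fun g x => ?_
  · exact ((he g).comp fun h => (lp.single 1 h (a g) : EllOne H)).continuous
  · simpa using (memℓp_gen_iff (by simp)).1 (lp.memℓp a)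
  · exact (lp.norm_single one_pos _ _).le

/-- The maps `ellOneCongr (e x)` are isometries, so replacing `ξ x` by `ξ x₀` costs only `dist (ξ x)
(ξ x₀)`; this leaves the case of a constant vector. -/
theorem continuous_ellOneCongr {G H X : Type*} [TopologicalSpace X] {e : X → G ≃ H}
    (he : ∀ g, IsLocallyConstant fun x => e x g) {ξ : X → EllOne G} (hξ : Continuous ξ) :
    Continuous fun x => ellOneCongr (e x) (ξ x) := by
  refine continuous_iff_continuousAt.2 fun x₀ => tendsto_iff_dist_tendsto_zero.2 ?_
  have h₁ := tendsto_iff_dist_tendsto_zero.1 (hξ.tendsto x₀)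
  have h₂ := tendsto_iff_dist_tendsto_zero.1
    ((continuous_ellOneCongr_const he (ξ x₀)).tendsto x₀)
  refine squeeze_zero (fun _ => dist_nonneg) (fun x => ?_) (by simpa using h₁.add h₂)
  rw [← (ellOneCongr (e x)).dist_map (ξ x)]
  exact dist_triangle _ _ _

/-- Multiplication by the indicator function of a clopen set. -/
def cutoff {X V : Type*} [TopologicalSpace X] [CompactSpace X] [NormedAddCommGroup V]
    [NormedSpace ℝ V] {s : Set X} (hs : IsClopen s) : C(X, V) →L[ℝ] C(X, V) :=
  LinearMap.mkContinuous
    { toFun := fun ξ => ⟨s.indicator ξ, hs.continuous_indicator ξ.continuous⟩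
      map_add' := fun ξ η => by
        ext1 x
        exact congrFun (s.indicator_add ξ η) x
      map_smul' := fun r ξ => by
        ext1 x
        exact congrFun (s.indicator_const_smul r ξ) x } 1 fun ξ => by
    rw [one_mul]
    refine (ContinuousMap.norm_le _ (norm_nonneg _)).2 fun x => ?_
    exact (norm_indicator_le_norm_self _ _).trans (ξ.norm_coe_le_norm x)

theorem cutoff_apply {X V : Type*} [TopologicalSpace X] [CompactSpace X] [NormedAddCommGroup V]
    [NormedSpace ℝ V] {s : Set X} (hs : IsClopen s) (ξ : C(X, V)) (x : X) :
    cutoff hs ξ x = s.indicator ξ x := rfl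

namespace TransformationGroupoidEquiv

variable {G X H Y : Type*} [Group G] [TopologicalSpace X] [CompactSpace X]
  [MulAction G X] [Group H] [TopologicalSpace Y] [CompactSpace Y]
  [MulAction H Y]
  (E : TransformationGroupoidEquiv G X H Y)

/-- The isomorphism `C(X, ℓ¹(G)) → C(Y, ℓ¹(H))` induced by an isomorphism of groupoids. -/
def transport : CEllOne G X →L[ℝ] CEllOne H Y :=
  LinearMap.mkContinuous
    { toFun := fun ξ => ⟨fun y => ellOneCongr (E.arrow (E.base.symm y)) (ξ (E.base.symm y)),
        (continuous_ellOneCongr E.isLocallyConstant_arrow ξ.continuous).comp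
          E.base.symm.continuous⟩
      map_add' := fun _ _ => rfl
      map_smul' := fun _ _ => rfl } 1 fun ξ => by
    rw [one_mul]
    refine (ContinuousMap.norm_le _ (norm_nonneg _)).2 fun y => ?_
    exact ((ellOneCongr _).norm_map _).trans_le (ξ.norm_coe_le_norm _)

theorem transport_apply (ξ : CEllOne G X) (y : Y) (h : H) :
    E.transport ξ y h = ξ (E.base.symm y) ((E.arrow (E.base.symm y)).symm h) := rfl

theorem transport_symm_apply (η : CEllOne H Y) (x : X) (g : G) :
    E.symm.transport η x g = η (E.base x) (E.arrow x g) := by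
  simp [transport_apply]

theorem transport_symm_transport (ξ : CEllOne G X) : E.symm.transport (E.transport ξ) = ξ := by
  ext x g
  simp [transport_apply]

theorem sigma_transport (ξ : CEllOne G X) (y : Y) :
    sigma H Y (E.transport ξ) y = sigma G X ξ (E.base.symm y) :=
  (E.arrow (E.base.symm y)).symm.tsum_eq fun g => ξ (E.base.symm y) g

theorem transport_mem_N0 {ξ : CEllOne G X} (hξ : ξ ∈ N0 G X) : E.transport ξ ∈ N0 H Y := by
  rw [mem_N0] at hξ ⊢
  intro y
  rw [sigma_transport, hξ]

theorem transport_mem_W0 {ξ : CEllOne G X} (hξ : ξ ∈ W0 G X) : E.transport ξ ∈ W0 H Y := by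
  rw [mem_W0] at hξ ⊢
  obtain ⟨r, hr⟩ := hξ
  exact ⟨r, fun y => by rw [sigma_transport, hr]⟩

end TransformationGroupoidEquiv

/-- The condition of zero sum is imposed at each point separately; a nonzero constant sum would not
survive. -/
theorem cutoff_mem_N0 {G X : Type*} [TopologicalSpace X] [CompactSpace X] {s : Set X}
    (hs : IsClopen s) {ξ : CEllOne G X} (hξ : ξ ∈ N0 G X) : cutoff hs ξ ∈ N0 G X := by
  rw [mem_N0] at hξ ⊢
  intro x
  rw [sigma_apply]
  by_cases hx : x ∈ s
  · simpa [cutoff_apply, hx, sigma_apply] using hξ x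
  · simp [cutoff_apply, hx]

end Transport

/-! ### Duality between chains and cochains -/

section Pairing

variable {ι V : Type*} [AddCommGroup V] [Module ℝ V] [TopologicalSpace V]

/-- The pairing of finitely supported maps `ι → V*` with arbitrary maps `ι → V`. -/
def pairing (ι V : Type*) [AddCommGroup V] [Module ℝ V] [TopologicalSpace V] :
    (ι →₀ StrongDual ℝ V) →ₗ[ℝ] Module.Dual ℝ (ι → V) :=
  Finsupp.lsum ℝ fun i =>
    { toFun := fun τ => τ.toLinearMap ∘ₗ LinearMap.proj i
      map_add' := fun _ _ => rfl
      map_smul' := fun _ _ => rfl }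

theorem pairing_single (i : ι) (τ : StrongDual ℝ V) (F : ι → V) :
    pairing ι V (Finsupp.single i τ) F = τ (F i) := by
  simp [pairing]

open Classical in
theorem pairing_pi_single [IsTopologicalAddGroup V] [ContinuousConstSMul ℝ V]
    (c : ι →₀ StrongDual ℝ V) (i : ι) (v : V) :
    pairing ι V c (Pi.single i v) = c i v := by
  induction c using Finsupp.induction_linear with
  | zero => simp
  | add c d hc hd => simp [hc, hd]
  | single j τ =>
    rw [pairing_single]
    by_cases h : j = i
    · subst h; simp
    · simp [h]

/-- Cochains supported at a single index recover every coefficient of a chain, so identities of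
chains can be checked on cochains. -/
theorem pairing_injective [IsTopologicalAddGroup V] [ContinuousConstSMul ℝ V] :
    Function.Injective (pairing ι V) := by
  classical
  intro c d h
  ext i v
  rw [← pairing_pi_single, h, pairing_pi_single]

end Pairing

section Coboundary

variable {G V : Type*} [Group G] [AddCommGroup V] [Module ℝ V] [TopologicalSpace V]
  [IsTopologicalAddGroup V]

/-- The inhomogeneous coboundary, to which the bar differential of the dual is adjoint. -/
def barCoboundary (ρ : G →* (V →L[ℝ] V)) (n : ℕ) (F : (Fin n → G) → V) (g : Fin (n + 1) → G) :
    V :=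
  ρ (g 0) (F fun i => g i.succ) +
    ∑ j : Fin (n + 1), (-1 : ℝ) ^ ((j : ℕ) + 1) • F (Fin.contractNth j (· * ·) g)

theorem barD_single (ρ : G →* (V →L[ℝ] V)) (n : ℕ) (g : Fin (n + 1) → G) (τ : StrongDual ℝ V) :
    barD (dualRep ρ) n (Finsupp.single g τ) =
      Finsupp.single (fun i => g i.succ) (τ.comp (ρ (g 0))) +
        ∑ j : Fin (n + 1), (-1 : ℝ) ^ ((j : ℕ) + 1) •
          Finsupp.single (Fin.contractNth j (· * ·) g) τ := by
  have h : dualRep ρ (g 0)⁻¹ τ = τ.comp (ρ (g 0)) := by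
    change τ.comp (ρ (g 0)⁻¹⁻¹) = _
    rw [inv_inv]
  simp only [barD, Finsupp.lsum_single, LinearMap.add_apply, LinearMap.comp_apply,
    LinearMap.sum_apply, LinearMap.smul_apply, Finsupp.lsingle_apply, h]

theorem pairing_barD [ContinuousConstSMul ℝ V] (ρ : G →* (V →L[ℝ] V)) (n : ℕ) (c : (Fin (n + 1) → G) →₀ StrongDual ℝ V)
    (F : (Fin n → G) → V) :
    pairing _ V (barD (dualRep ρ) n c) F = pairing _ V c (barCoboundary ρ n F) := by
  induction c using Finsupp.induction_linear with
  | zero => simp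
  | add c d hc hd => simp only [map_add, LinearMap.add_apply, hc, hd]
  | single g τ =>
    simp only [barD_single, map_add, map_sum, map_smul, LinearMap.add_apply, LinearMap.sum_apply,
      LinearMap.smul_apply, pairing_single, barCoboundary, ContinuousLinearMap.comp_apply]

end Coboundary

/-! ### The isomorphism of bar complexes for `N₀*` -/

namespace TransformationGroupoidEquiv

variable {G X H Y : Type*} [Group G] [TopologicalSpace X] [CompactSpace X]
  [MulAction G X] [Group H] [TopologicalSpace Y] [MulAction H Y]
  (E : TransformationGroupoidEquiv G X H Y)

/-- The finitely many images of a string of arrows. -/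
def images {n : ℕ} (g : Fin n → G) : Finset (Fin n → H) :=
  (E.isLocallyConstant_arrowSeq g).range_finite.toFinset

theorem arrowSeq_mem_images {n : ℕ} (g : Fin n → G) (x : X) : E.arrowSeq x g ∈ E.images g := by
  simp [images]

variable [CompactSpace Y]

/-- The map `N₀(H, Y) → N₀(G, X)` that transports and cuts off to the clopen set of those `x`
over which the string `g` is sent to `h`. -/
def cutoffTransport {n : ℕ} (g : Fin n → G) (h : Fin n → H) : N0 H Y →L[ℝ] N0 G X :=
  ((cutoff ((E.isLocallyConstant_arrowSeq g).isClopen_fiber h)).comp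
    (E.symm.transport.comp (N0 H Y).subtypeL)).codRestrict (N0 G X) fun η =>
      cutoff_mem_N0 ((E.isLocallyConstant_arrowSeq g).isClopen_fiber h)
        (E.symm.transport_mem_N0 η.2)

open Classical in
theorem cutoffTransport_apply {n : ℕ} (g : Fin n → G) (h : Fin n → H) (η : N0 H Y) (x : X)
    (k : G) :
    (E.cutoffTransport g h η : CEllOne G X) x k =
      if E.arrowSeq x g = h then (η : CEllOne H Y) (E.base x) (E.arrow x k) else 0 := by
  change Set.indicator {x | E.arrowSeq x g = h} (E.symm.transport (η : CEllOne H Y)) x k = _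
  rw [Set.indicator_apply]
  split_ifs with h₁ h₂ h₂
  · rw [transport_symm_apply]
  · exact absurd h₁ h₂
  · exact absurd h₂ h₁
  · rfl

/-- The pullback of maps `Hⁿ → N₀(H, Y)` to maps `Gⁿ → N₀(G, X)`. -/
def pull {n : ℕ} (F : (Fin n → H) → N0 H Y) (g : Fin n → G) : N0 G X :=
  ∑ h ∈ E.images g, E.cutoffTransport g h (F h)

/-- The cutoff sets partition `X`, so exactly one summand is active at each `x`. -/
theorem pull_apply {n : ℕ} (F : (Fin n → H) → N0 H Y) (g : Fin n → G) (x : X) (k : G) :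
    (E.pull F g : CEllOne G X) x k =
      (F (E.arrowSeq x g) : CEllOne H Y) (E.base x) (E.arrow x k) := by
  classical
  simp only [pull, Submodule.coe_sum, ContinuousMap.sum_apply, lp.coeFn_sum, Finset.sum_apply,
    cutoffTransport_apply]
  rw [Finset.sum_ite_eq, if_pos (E.arrowSeq_mem_images g x)]

theorem _root_.COEHomology.N0_ext {G X : Type*} [TopologicalSpace X] {ξ η : N0 G X}
    (h : ∀ x k, (ξ : CEllOne G X) x k = (η : CEllOne G X) x k) : ξ = η := by
  ext x k
  exact h x k

theorem pull_symm_pull {n : ℕ} (F : (Fin n → G) → N0 G X) : E.pull (E.symm.pull F) = F := by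
  ext1 g
  refine N0_ext fun x k => ?_
  rw [pull_apply, pull_apply, arrowSeq_symm_arrowSeq]
  simp

/-- The map of bar complexes induced by an isomorphism of transformation groupoids. -/
def chainMap (n : ℕ) :
    ((Fin n → G) →₀ StrongDual ℝ (N0 G X)) →ₗ[ℝ] ((Fin n → H) →₀ StrongDual ℝ (N0 H Y)) :=
  Finsupp.lsum ℝ fun g => ∑ h ∈ E.images g, Finsupp.lsingle h ∘ₗ
    { toFun := fun τ => τ.comp (E.cutoffTransport g h)
      map_add' := fun _ _ => rfl
      map_smul' := fun _ _ => rfl }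

theorem pairing_chainMap {n : ℕ} (c : (Fin n → G) →₀ StrongDual ℝ (N0 G X))
    (F : (Fin n → H) → N0 H Y) :
    pairing _ _ (E.chainMap n c) F = pairing _ _ c (E.pull F) := by
  induction c using Finsupp.induction_linear with
  | zero => simp
  | add c d hc hd => simp only [map_add, LinearMap.add_apply, hc, hd]
  | single g τ =>
    simp only [chainMap, Finsupp.lsum_single, LinearMap.sum_apply, LinearMap.comp_apply,
      Finsupp.lsingle_apply, map_sum, pairing_single, pull]
    rfl

theorem chainMap_symm_chainMap {n : ℕ} (c : (Fin n → G) →₀ StrongDual ℝ (N0 G X)) :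
    E.symm.chainMap n (E.chainMap n c) = c := by
  apply pairing_injective
  ext1 F
  rw [pairing_chainMap, pairing_chainMap, pull_symm_pull]

theorem chainMap_chainMap_symm {n : ℕ} (c : (Fin n → H) →₀ StrongDual ℝ (N0 H Y)) :
    E.chainMap n (E.symm.chainMap n c) = c := by
  simpa only [symm_symm] using E.symm.chainMap_symm_chainMap c

/-- The isomorphism of bar complexes induced by an isomorphism of transformation groupoids. -/
def chainEquiv (n : ℕ) :
    ((Fin n → G) →₀ StrongDual ℝ (N0 G X)) ≃ₗ[ℝ] ((Fin n → H) →₀ StrongDual ℝ (N0 H Y)) :=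
  LinearEquiv.ofLinearMap (E.chainMap n) (E.symm.chainMap n)
    (LinearMap.ext E.chainMap_chainMap_symm) (LinearMap.ext E.chainMap_symm_chainMap)

/-- The isomorphism `W₀(G, X) → W₀(H, Y)`, in one direction. -/
def transportW0 : W0 G X →L[ℝ] W0 H Y :=
  (E.transport.comp (W0 G X).subtypeL).codRestrict (W0 H Y) fun ξ => E.transport_mem_W0 ξ.2

theorem transportW0_symm_transportW0 (ξ : W0 G X) : E.symm.transportW0 (E.transportW0 ξ) = ξ :=
  Subtype.ext (E.transport_symm_transport _)

theorem transportW0_transportW0_symm (η : W0 H Y) : E.transportW0 (E.symm.transportW0 η) = η := by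
  simpa only [symm_symm] using E.symm.transportW0_symm_transportW0 η

/-- The isomorphism `W₀(G, X)* → W₀(H, Y)*`. -/
def dualTransportW0 : StrongDual ℝ (W0 G X) ≃ₗ[ℝ] StrongDual ℝ (W0 H Y) where
  toFun τ := τ.comp E.symm.transportW0
  invFun τ := τ.comp E.transportW0
  map_add' _ _ := rfl
  map_smul' _ _ := rfl
  left_inv τ := by
    ext1 ξ
    exact congrArg τ (E.transportW0_symm_transportW0 ξ)
  right_inv τ := by
    ext1 ξ
    exact congrArg τ (E.transportW0_transportW0_symm ξ)

/-- The isomorphism of bar `0`-chains with values in `W₀*`. -/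
def chainEquivW0 :
    ((Fin 0 → G) →₀ StrongDual ℝ (W0 G X)) ≃ₗ[ℝ] ((Fin 0 → H) →₀ StrongDual ℝ (W0 H Y)) :=
  Finsupp.lcongr (Equiv.ofUnique _ _) E.dualTransportW0

theorem symm_chainEquivW0_chainEquivW0 (c : (Fin 0 → G) →₀ StrongDual ℝ (W0 G X)) :
    E.symm.chainEquivW0 (E.chainEquivW0 c) = c := by
  have h : E.symm.dualTransportW0 = E.dualTransportW0.symm := by
    ext1 τ
    change τ.comp E.symm.symm.transportW0 = τ.comp E.transportW0
    rw [symm_symm]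
  have hsymm : E.symm.chainEquivW0 = E.chainEquivW0.symm := by
    rw [chainEquivW0, chainEquivW0, h, Finsupp.lcongr_symm]
    rfl
  rw [hsymm, LinearEquiv.symm_apply_apply]

variable [ContinuousConstSMul G X] [ContinuousConstSMul H Y]

theorem _root_.COEHomology.N0Action_apply {G X : Type*} [Group G] [TopologicalSpace X]
    [MulAction G X] [ContinuousConstSMul G X] (g : G) (ξ : N0 G X) (x : X) (k : G) :
    (N0Action G X g ξ : CEllOne G X) x k = (ξ : CEllOne G X) (g⁻¹ • x) (g⁻¹ * k) := rfl

/-- Each operation in the coboundary (shifting by the first arrow, composing neighbours, dropping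
the last arrow) is a groupoid operation, which `E` preserves. -/
theorem pull_barCoboundary (n : ℕ) (F : (Fin n → H) → N0 H Y) :
    E.pull (barCoboundary (N0Action H Y) n F) = barCoboundary (N0Action G X) n (E.pull F) := by
  ext1 g
  refine N0_ext fun x k => ?_
  rw [pull_apply]
  simp only [barCoboundary, Submodule.coe_add, Submodule.coe_sum, Submodule.coe_smul,
    ContinuousMap.add_apply, ContinuousMap.sum_apply, ContinuousMap.smul_apply, lp.coeFn_add,
    lp.coeFn_sum, lp.coeFn_smul, Pi.add_apply, Pi.smul_apply, Finset.sum_apply, N0Action_apply,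
    pull_apply, arrowSeq_contractNth, arrowSeq_zero, arrowSeq_tail, arrow_inv_smul,
    base_inv_smul]

theorem chainMap_barD (n : ℕ) (c : (Fin (n + 1) → G) →₀ StrongDual ℝ (N0 G X)) :
    E.chainMap n (barD (dualRep (N0Action G X)) n c) =
      barD (dualRep (N0Action H Y)) n (E.chainMap (n + 1) c) := by
  apply pairing_injective
  ext1 F
  rw [pairing_chainMap, pairing_barD, pairing_barD, pairing_chainMap, pull_barCoboundary]

end TransformationGroupoidEquiv

/-! ### From chains to homology -/

section HomologyEquiv

variable {G V H W : Type*} [Group G] [AddCommGroup V] [Module ℝ V] [Group H] [AddCommGroup W]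
  [Module ℝ W] {ρ : Representation ℝ G V} {π : Representation ℝ H W}

/-- Only degree `n` is compared: for `W₀*` in degree zero no isomorphism of `1`-chains is at hand.
-/
theorem nonempty_barHomology_equiv (n : ℕ) (e : ((Fin n → G) →₀ V) ≃ₗ[ℝ] ((Fin n → H) →₀ W))
    (hcycles : ∀ c, c ∈ barCycles ρ n ↔ e c ∈ barCycles π n)
    (hrange : ∀ c, c ∈ LinearMap.range (barD ρ n) ↔ e c ∈ LinearMap.range (barD π n)) :
    Nonempty (barHomology ρ n ≃ₗ[ℝ] barHomology π n) := by
  have hmap : (barCycles ρ n).map e.toLinearMap = barCycles π n := by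
    ext d
    rw [Submodule.mem_map]
    exact ⟨fun ⟨c, hc, hd⟩ => hd ▸ (hcycles c).1 hc, fun hd =>
      ⟨e.symm d, (hcycles _).2 (by simpa using hd), by simp⟩⟩
  refine ⟨Submodule.Quotient.equiv _ _ (e.ofSubmodules _ _ hmap) ?_⟩
  ext d
  rw [Submodule.mem_map]
  constructor
  · rintro ⟨c, hc, rfl⟩
    exact (hrange c).1 hc
  · intro hd
    refine ⟨(e.ofSubmodules _ _ hmap).symm d, (hrange _).2 ?_, by simp⟩
    simpa [Submodule.submoduleOf] using hd

end HomologyEquiv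

namespace TransformationGroupoidEquiv

variable {G X H Y : Type*} [Group G] [TopologicalSpace X] [CompactSpace X]
  [MulAction G X] [ContinuousConstSMul G X] [Group H] [TopologicalSpace Y] [CompactSpace Y]
  [MulAction H Y] [ContinuousConstSMul H Y] (E : TransformationGroupoidEquiv G X H Y)

theorem chainEquiv_barD (n : ℕ) (c : (Fin (n + 1) → G) →₀ StrongDual ℝ (N0 G X)) :
    E.chainEquiv n (barD (dualRep (N0Action G X)) n c) =
      barD (dualRep (N0Action H Y)) n (E.chainEquiv (n + 1) c) :=
  E.chainMap_barD n c

theorem nonempty_homologyN0Dual_equiv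
    (E : TransformationGroupoidEquiv G X H Y) (n : ℕ) :
    Nonempty (homologyN0Dual G X n ≃ₗ[ℝ] homologyN0Dual H Y n) := by
  refine nonempty_barHomology_equiv n (E.chainEquiv n) (fun c => ?_) fun c => ?_
  · cases n with
    | zero => simp [barCycles]
    | succ n =>
      simp only [barCycles, LinearMap.mem_ker]
      rw [← chainEquiv_barD, LinearEquiv.map_eq_zero_iff]
  · simp only [LinearMap.mem_range]
    constructor
    · rintro ⟨d, rfl⟩
      exact ⟨E.chainEquiv (n + 1) d, (E.chainEquiv_barD n d).symm⟩
    · rintro ⟨d, hd⟩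
      refine ⟨(E.chainEquiv (n + 1)).symm d, (E.chainEquiv n).injective ?_⟩
      rw [chainEquiv_barD, LinearEquiv.apply_symm_apply, hd]

/-! ### Degree zero with coefficients in `W₀*` -/

/-- The map `g - 1 : W₀(G, X) → N₀(G, X)`. -/
def _root_.COEHomology.W0ActionSubOne (G X : Type*) [Group G] [TopologicalSpace X]
    [MulAction G X] [ContinuousConstSMul G X] (g : G) : W0 G X →L[ℝ] N0 G X :=
  ((translate g - ContinuousLinearMap.id ℝ (CEllOne G X)).comp
    (W0 G X).subtypeL).codRestrict (N0 G X) fun ξ => by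
      obtain ⟨r, hr⟩ := (mem_W0 _).1 ξ.2
      rw [mem_N0]
      intro x
      change sigma G X (translate g (ξ : CEllOne G X) - (ξ : CEllOne G X)) x = 0
      rw [map_sub, ContinuousMap.sub_apply, sigma_translate, hr, hr, sub_self]

theorem _root_.COEHomology.W0ActionSubOne_apply {G X : Type*} [Group G] [TopologicalSpace X]
    [MulAction G X] [ContinuousConstSMul G X] (g : G) (ξ : W0 G X) (x : X) (k : G) :
    (W0ActionSubOne G X g ξ : CEllOne G X) x k =
      (ξ : CEllOne G X) (g⁻¹ • x) (g⁻¹ * k) - (ξ : CEllOne G X) x k := rfl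

theorem _root_.COEHomology.N0_le_W0 (G X : Type*) [TopologicalSpace X] : N0 G X ≤ W0 G X :=
  fun ξ hξ => (mem_W0 ξ).2 ⟨0, (mem_N0 ξ).1 hξ⟩

/-- Hahn–Banach extension of functionals from `N₀` to `W₀`. -/
theorem _root_.COEHomology.exists_extend_dual_N0 {G X : Type*} [TopologicalSpace X]
    [CompactSpace X] (τ : StrongDual ℝ (N0 G X)) :
    ∃ τ' : StrongDual ℝ (W0 G X), ∀ ξ : N0 G X, τ' ⟨ξ, N0_le_W0 G X ξ.2⟩ = τ ξ := by
  obtain ⟨τ', h, -⟩ := exists_extension_norm_eq (N0 G X) τ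
  exact ⟨τ'.comp (W0 G X).subtypeL, h⟩

/-- The boundary is `τ ∘ (g - 1)`, and `g - 1` takes values in `N₀`; hence it depends only on `τ`
restricted to `N₀`. -/
theorem _root_.COEHomology.barD_W0_single {G X : Type*} [Group G] [TopologicalSpace X]
    [MulAction G X] [ContinuousConstSMul G X] (g : Fin 1 → G) (τ : StrongDual ℝ (W0 G X))
    (τ' : StrongDual ℝ (N0 G X)) (h : ∀ ξ : N0 G X, τ ⟨ξ, N0_le_W0 G X ξ.2⟩ = τ' ξ) :
    barD (dualRep (W0Action G X)) 0 (Finsupp.single g τ) =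
      Finsupp.single default (τ'.comp (W0ActionSubOne G X (g 0))) := by
  have key : τ'.comp (W0ActionSubOne G X (g 0)) = τ.comp (W0Action G X (g 0)) - τ := by
    ext1 ξ
    rw [ContinuousLinearMap.comp_apply, ← h, sub_apply,
      ContinuousLinearMap.comp_apply, ← map_sub]
    rfl
  refine Finsupp.ext fun i => ?_
  obtain rfl := Subsingleton.elim i default
  rw [barD_single, key]
  ext1 ξ
  simp [sub_eq_add_neg, Subsingleton.elim _ (default : Fin 0 → G)]

/-- The cochain `h ↦ (h - 1) η` takes values in `N₀` although `η` is only in `W₀`, so it can be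
pulled back; the result is the analogous cochain of the transported `η`. -/
theorem sum_cutoffTransport_W0ActionSubOne (g : Fin 1 → G) (η : W0 H Y) :
    ∑ h ∈ E.images g, E.cutoffTransport g h (W0ActionSubOne H Y (h 0) η) =
      W0ActionSubOne G X (g 0) (E.symm.transportW0 η) := by
  refine N0_ext fun x k => ?_
  have := E.pull_apply (fun h => W0ActionSubOne H Y (h 0) η) g x k
  rw [pull] at this
  rw [this, W0ActionSubOne_apply, W0ActionSubOne_apply, arrowSeq_zero, ← base_inv_smul,
    ← arrow_inv_smul]
  change _ = E.symm.transport (η : CEllOne H Y) _ _ - E.symm.transport (η : CEllOne H Y) _ _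
  rw [transport_symm_apply, transport_symm_apply]

theorem chainEquivW0_mem_range (c : (Fin 0 → G) →₀ StrongDual ℝ (W0 G X))
    (hc : c ∈ LinearMap.range (barD (dualRep (W0Action G X)) 0)) :
    E.chainEquivW0 c ∈ LinearMap.range (barD (dualRep (W0Action H Y)) 0) := by
  obtain ⟨d, rfl⟩ := hc
  induction d using Finsupp.induction_linear with
  | zero => simp
  | add d e hd he => simpa only [map_add] using add_mem hd he
  | single g τ =>
    set τ₀ : StrongDual ℝ (N0 G X) := τ.comp
      ((N0 G X).subtypeL.codRestrict (W0 G X) fun ξ => N0_le_W0 G X ξ.2)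
    -- The cut-off functionals live on `N₀(H, Y)` only; any extensions to `W₀(H, Y)` serve, since
    -- the boundary does not see the choice.
    choose σ hσ using fun h => exists_extend_dual_N0 (τ₀.comp (E.cutoffTransport g h))
    refine ⟨∑ h ∈ E.images g, Finsupp.single h (σ h), ?_⟩
    rw [barD_W0_single g τ τ₀ fun _ => rfl, map_sum,
      Finset.sum_congr rfl fun h _ => barD_W0_single h (σ h) _ (hσ h), chainEquivW0,
      Finsupp.lcongr_single, ← Finsupp.single_finsetSum]
    congr 1
    ext1 η
    change _ = τ₀ (W0ActionSubOne G X (g 0) (E.symm.transportW0 η))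
    rw [← sum_cutoffTransport_W0ActionSubOne, map_sum, sum_apply]
    rfl

theorem nonempty_ufHomology_zero_equiv
    (E : TransformationGroupoidEquiv G X H Y) :
    Nonempty (ufHomology G X 0 ≃ₗ[ℝ] ufHomology H Y 0) := by
  refine nonempty_barHomology_equiv 0 E.chainEquivW0 (fun c => ?_) fun c => ?_
  · simp [barCycles]
  · refine ⟨E.chainEquivW0_mem_range c, fun h => ?_⟩
    have := E.symm.chainEquivW0_mem_range _ h
    rwa [symm_chainEquivW0_chainEquivW0] at this

end TransformationGroupoidEquiv

end COEHomology

end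

theorem theorem1p1
    {G H X Y : Type*}
    [Group G] [Countable G] [TopologicalSpace G] [DiscreteTopology G]
    [Group H] [Countable H] [TopologicalSpace H] [DiscreteTopology H]
    [TopologicalSpace X] [CompactSpace X] [T2Space X] [MulAction G X] [ContinuousConstSMul G X]
    [TopologicalSpace Y] [CompactSpace Y] [T2Space Y] [MulAction H Y] [ContinuousConstSMul H Y]
    (hX : COEHomology.TopologicallyFree G X) (hY : COEHomology.TopologicallyFree H Y)
    (hcoe : COEHomology.ContinuouslyOrbitEquivalent G X H Y) :
    Nonempty (COEHomology.ufHomology G X 0 ≃ₗ[ℝ] COEHomology.ufHomology H Y 0) ∧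
      ∀ n : ℕ, Nonempty
        (COEHomology.homologyN0Dual G X n ≃ₗ[ℝ] COEHomology.homologyN0Dual H Y n) := by
  obtain ⟨E⟩ := hcoe.exists_transformationGroupoidEquiv hX hY
  exact ⟨E.nonempty_ufHomology_zero_equiv, E.nonempty_homologyN0Dual_equiv⟩
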